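/- Let $d\in\mathbb N$, $\alpha\in(0,1)$, $q>0$, $\beta_1,\dots,\beta_d,\beta_Z>0$, and $\lambda_1,\dots,\lambda_d,\lambda_Z,a_1,\dots,a_d\ge 0$. For $\beta>0$, $\lambda\ge 0$ write $\mathcal ET\alpha S(\alpha,\beta,\lambda)$ for the (drift-free, positive) exponential tempered $\alpha$-stable law on $\mathbb R$, i.e. the infinitely divisible law without Gaussian part and without drift whose Lévy measure is $\lambda\,e^{-\beta r}r^{-\alpha-1}\mathbf 1_{r>0}\,dr$. A Sato subordinator with exponent $q$ is a real additive process (started at $0$, independent increments, stochastically continuous, càdlàg) with increasing trajectories which is $q$-self-similar: for every $c>0$ the processes $(X(ct))_{t\ge0}$ and $(c^qX(t))_{t\ge0}$ have the same law. Let $S_j(t)=X_j(t)+a_jZ(t)$, $j=1,\dots,d$, be the factor-based $\mathcal ET\alpha S$ Sato subordinator: $X_1,\dots,X_d,Z$ are independent Sato subordinators with exponent $q$, $X_j(1)\sim\mathcal ET\alpha S(\alpha,\beta_j,\lambda_j)$ and $Z(1)\sim\mathcal ET\alpha S(\alpha,\beta_Z,\lambda_Z)$. Let $B_1,\dots,B_d$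 be independent real Brownian motions, $B_j$ with drift $\mu_j\in\mathbb R$ and diffusion $\sigma_j\ge0$ (so $B_j(s)\sim N(\mu_js,\sigma_j^2s)$), and let $\boldsymbol B^\rho$ be a $d$-dimensional Brownian motion, independent of $(B_1,\dots,B_d)$, with drift $\boldsymbol\mu^\rho=(\mu_ja_j)_j$ and covariance matrix $\boldsymbol\Sigma^\rho=(\rho_{ij}\sigma_i\sigma_j\sqrt{a_i}\sqrt{a_j})_{ij}$, where $(\rho_{ij})$ is a correlation matrix (symmetric, positive semidefinite, with unit diagonal). Assume that $(X_1,\dots,X_d,Z)$ is independent of $(B_1,\dots,B_d,\boldsymbol B^\rho)$, and let $\boldsymbol Y^\rho(t)$ be the $\rho$-factor-based Sato-subordinated Brownian motion $$Y^\rho_j(t)=B_j(X_j(t))+B^\rho_j(Z(t)),\qquad j=1,\dots,d.$$ Then for every $t>0$ and every $\boldsymbol z\in\mathbb R^d$ the characteristic function $\hat\mu_t(\boldsymbol z)=\mathbb E[e^{i\langle\boldsymbol z,\boldsymbol Y^\rho(t)\rangle}]$ is $$\hat\mu_t(\boldsymbol z)=\prod_{j=1}^d\exp\Big\{\Gamma(-\alpha)\Big[\big(\beta_j-t^q(i\mu_jz_j-\tfrac12\sigma_j^2z_j^2)\big)^{\alpha}-\beta_j^{\alpha}\Big]\lambda_j\Big\}\cdot\exp\Big\{\Gamma(-\alpha)\Big[\big(\beta_Z-t^q(i\boldsymbol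 z^{T}\boldsymbol\mu^\rho-\tfrac12\boldsymbol z^{T}\boldsymbol\Sigma^\rho\boldsymbol z)\big)^{\alpha}-\beta_Z^{\alpha}\Big]\lambda_Z\Big\},$$ with the principal branch of the complex power. -/

import Mathlib

open MeasureTheory ProbabilityTheory Filter Topology
open scoped NNReal ENNReal Matrix

noncomputable section

/-! ### Exponential tempered stable laws -/

/-- The Lévy measure with polar decomposition
`ν(A) = ∫_{S} ∫_0^∞ 1_A(r w) e^{-β(w) r} / r^{α+1} dr lam(dw)`, where `S` is the unit sphere. -/
def etsLevyMeasure {E : Type*} [NormedAddCommGroup E] [NormedSpace ℝ E] [MeasurableSpace E]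
    (α : ℝ) (β : Metric.sphere (0 : E) 1 → ℝ) (lam : Measure (Metric.sphere (0 : E) 1)) :
    Measure E :=
  ((lam.prod (volume.restrict (Set.Ioi (0 : ℝ)))).withDensity
    (fun p => ENNReal.ofReal (Real.exp (-(β p.1 * p.2)) / p.2 ^ (α + 1)))).map
    (fun p => p.2 • (p.1 : E))

/-- `μ` is the exponential tempered `α`-stable law with parameters `α ∈ (0,1)`, `β : S → (0,∞)`
and the finite measure `lam` on the unit sphere `S`: the infinitely divisible law with no Gaussian
part, no drift, and Lévy measure `etsLevyMeasure α β lam`.  For `α ∈ (0,1)` the Lévy measure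
integrates `min 1 ‖x‖`, hence the Lévy-Khintchine formula needs no compensator. -/
structure IsETS {E : Type*} [NormedAddCommGroup E] [InnerProductSpace ℝ E] [MeasurableSpace E]
    (α : ℝ) (β : Metric.sphere (0 : E) 1 → ℝ) (lam : Measure (Metric.sphere (0 : E) 1))
    (μ : Measure E) : Prop where
  alpha_pos : 0 < α
  alpha_lt_one : α < 1
  beta_measurable : Measurable β
  beta_pos : ∀ w, 0 < β w
  finite : IsFiniteMeasure lam
  prob : IsProbabilityMeasure μ
  charFun_eq : ∀ z : E, charFun μ z =
    Complex.exp (∫ x, (Complex.exp ((inner ℝ x z : ℝ) * Complex.I) - 1) ∂(etsLevyMeasure α β lam))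

/-- The one-dimensional, positive case: the spherical measure on `S = {-1, 1}` is the mass `lam`
at the point `1`, and the tempering parameter there is `β`. -/
def IsPosETS (α β lam : ℝ) (μ : Measure ℝ) : Prop :=
  IsETS α (fun _ : Metric.sphere (0 : ℝ) 1 => β)
    (ENNReal.ofReal lam • Measure.dirac (⟨1, by simp⟩ : Metric.sphere (0 : ℝ) 1)) μ

/-! ### Additive processes, Sato processes, Sato subordinators -/

/-- Additive process: starts at `0`, has independent increments, is stochastically continuous and
almost surely càdlàg. -/
structure IsAdditiveProcess {Ω E : Type*} [MeasurableSpace Ω] [NormedAddCommGroup E]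
    [MeasurableSpace E] (X : ℝ≥0 → Ω → E) (P : Measure Ω) : Prop where
  measurable : ∀ t, Measurable (X t)
  zero : ∀ᵐ ω ∂P, X 0 ω = 0
  indep : HasIndepIncrements X P
  stoch_cont : ∀ t, TendstoInMeasure P X (𝓝 t) (X t)
  cadlag : ∀ᵐ ω ∂P, ∀ t, ContinuousWithinAt (fun s => X s ω) (Set.Ici t) t ∧
    ∃ l, Tendsto (fun s => X s ω) (𝓝[<] t) (𝓝 l)

/-- Sato process with exponent `q`: an additive process that is `q`-self-similar, i.e. for every
`c > 0` the processes `X (c t)` and `c ^ q X t` (indexed by `t`) have the same law. -/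
structure IsSatoProcess {Ω E : Type*} [MeasurableSpace Ω] [NormedAddCommGroup E]
    [NormedSpace ℝ E] [MeasurableSpace E] (q : ℝ) (X : ℝ≥0 → Ω → E) (P : Measure Ω) : Prop
    extends IsAdditiveProcess X P where
  exponent_pos : 0 < q
  self_similar : ∀ c : ℝ≥0, 0 < c →
    IdentDistrib (fun ω (t : ℝ≥0) => X (c * t) ω) (fun ω (t : ℝ≥0) => (c : ℝ) ^ q • X t ω) P P

/-- One-dimensional Sato subordinator: a real Sato process with increasing trajectories (they are
nonnegative because they start at `0`). -/
structure IsSatoSubordinator {Ω : Type*} [MeasurableSpace Ω] (q : ℝ) (X : ℝ≥0 → Ω → ℝ)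
    (P : Measure Ω) : Prop extends IsSatoProcess q X P where
  mono : ∀ᵐ ω ∂P, Monotone (fun t => X t ω)

/-- The factor-based exponential tempered stable Sato subordinator
`S_j(t) = X_j(t) + a_j Z(t)`: the idiosyncratic factors `X_j` and the common factor `Z` are
independent Sato subordinators with the same exponent `q`, with unit-time laws
`X_j(1) ∼ ETS(α, β_j, lam_j)` and `Z(1) ∼ ETS(α, β_Z, lam_Z)`. -/
structure IsFactorSatoSubordinator {Ω : Type*} [MeasurableSpace Ω] {d : ℕ} (α q : ℝ)
    (a β lam : Fin d → ℝ) (βZ lamZ : ℝ) (S : ℝ≥0 → Ω → EuclideanSpace ℝ (Fin d))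
    (X : Fin d → ℝ≥0 → Ω → ℝ) (Z : ℝ≥0 → Ω → ℝ) (P : Measure Ω) : Prop where
  a_nonneg : ∀ j, 0 ≤ a j
  lam_nonneg : ∀ j, 0 ≤ lam j
  lamZ_nonneg : 0 ≤ lamZ
  sato_X : ∀ j, IsSatoSubordinator q (X j) P
  sato_Z : IsSatoSubordinator q Z P
  law_X : ∀ j, IsPosETS α (β j) (lam j) (P.map (X j 1))
  law_Z : IsPosETS α βZ lamZ (P.map (Z 1))
  indep_X : iIndepFun (fun j ω (t : ℝ≥0) => X j t ω) P
  indep_X_Z : IndepFun (fun ω (j : Fin d) (t : ℝ≥0) => X j t ω) (fun ω (t : ℝ≥0) => Z t ω) P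
  S_eq : ∀ t ω j, S t ω j = X j t ω + a j * Z t ω

/-! ### Brownian motions and the subordinated process -/

/-- A process started at `0` with independent increments, almost surely continuous paths and
`W t - W s ∼ law (t - s)` for `s ≤ t`. -/
structure IsContinuousWithIncrementLaw {Ω E : Type*} [MeasurableSpace Ω] [NormedAddCommGroup E]
    [MeasurableSpace E] (law : ℝ≥0 → Measure E) (W : ℝ≥0 → Ω → E) (P : Measure Ω) : Prop where
  measurable : ∀ t, Measurable (W t)
  zero : ∀ᵐ ω ∂P, W 0 ω = 0
  indep : HasIndepIncrements W P
  increments : ∀ s t, s ≤ t → HasLaw (fun ω => W t ω - W s ω) (law (t - s)) P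
  continuous : ∀ᵐ ω ∂P, Continuous (fun t => W t ω)

/-- Real Brownian motion with drift `m` and diffusion `σ`: `W t ∼ N(m t, σ² t)`. -/
def IsRealBM {Ω : Type*} [MeasurableSpace Ω] (m σ : ℝ) (W : ℝ≥0 → Ω → ℝ) (P : Measure Ω) : Prop :=
  IsContinuousWithIncrementLaw
    (fun t => gaussianReal (m * (t : ℝ)) (Real.toNNReal (σ ^ 2 * (t : ℝ)))) W P

/-- `d`-dimensional Brownian motion with drift vector `m` and covariance matrix `C`:
`W t ∼ N(t m, t C)`. -/
def IsVectorBM {Ω : Type*} [MeasurableSpace Ω] {d : ℕ} (m : Fin d → ℝ)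
    (C : Matrix (Fin d) (Fin d) ℝ) (W : ℝ≥0 → Ω → EuclideanSpace ℝ (Fin d)) (P : Measure Ω) :
    Prop :=
  IsContinuousWithIncrementLaw
    (fun t => multivariateGaussian (WithLp.toLp 2 ((t : ℝ) • m)) ((t : ℝ) • C)) W P

/-- The drift `μ^ρ_j = μ_j a_j` of the correlated Brownian motion. -/
def rhoDrift {d : ℕ} (a m : Fin d → ℝ) : Fin d → ℝ := fun j => m j * a j

/-- The matrix `Σ^ρ_{ij} = ρ_{ij} σ_i σ_j √a_i √a_j` of the correlated Brownian motion. -/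
def rhoCov {d : ℕ} (a σ : Fin d → ℝ) (ρ : Matrix (Fin d) (Fin d) ℝ) :
    Matrix (Fin d) (Fin d) ℝ :=
  Matrix.of fun i j => ρ i j * σ i * σ j * √(a i) * √(a j)

/-- The Brownian ingredients: independent real Brownian motions `B_j` with drift `m_j` and
diffusion `σ_j`, and, independent of them, a `d`-dimensional Brownian motion `Bρ` with correlation
matrix `ρ`, drift `rhoDrift a m` and covariance matrix `rhoCov a σ ρ`. -/
structure IsRhoBrownianPair {Ω : Type*} [MeasurableSpace Ω] {d : ℕ} (a m σ : Fin d → ℝ)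
    (ρ : Matrix (Fin d) (Fin d) ℝ) (B : Fin d → ℝ≥0 → Ω → ℝ)
    (Bρ : ℝ≥0 → Ω → EuclideanSpace ℝ (Fin d)) (P : Measure Ω) : Prop where
  sigma_nonneg : ∀ j, 0 ≤ σ j
  corr_posSemidef : ρ.PosSemidef
  corr_diag : ∀ j, ρ j j = 1
  brownian_B : ∀ j, IsRealBM (m j) (σ j) (B j) P
  brownian_Bρ : IsVectorBM (rhoDrift a m) (rhoCov a σ ρ) Bρ P
  indep_B : iIndepFun (fun j ω (t : ℝ≥0) => B j t ω) P
  indep_B_Bρ : IndepFun (fun ω (j : Fin d) (t : ℝ≥0) => B j t ω) (fun ω (t : ℝ≥0) => Bρ t ω) P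

/-- The `ρ`-factor-based Sato-subordinated Brownian motion
`Y^ρ_j(t) = B_j(X_j(t)) + Bρ_j(Z(t))`.  The random times are almost surely nonnegative. -/
def rhoFactorProcess {Ω : Type*} {d : ℕ} (X : Fin d → ℝ≥0 → Ω → ℝ) (Z : ℝ≥0 → Ω → ℝ)
    (B : Fin d → ℝ≥0 → Ω → ℝ) (Bρ : ℝ≥0 → Ω → EuclideanSpace ℝ (Fin d)) (t : ℝ≥0) (ω : Ω) :
    EuclideanSpace ℝ (Fin d) :=
  WithLp.toLp 2 fun j => B j (X j t ω).toNNReal ω + Bρ (Z t ω).toNNReal ω j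

end

/-! At deterministic times `s` the Brownian part has characteristic function `∏ exp(φ_j s_j) · exp(ψ
s_Z)`, where `φ_j` and `ψ` have nonpositive real part. Averaging over the independent clocks
(`charFun_subordinatedValue`) leaves a product of Laplace transforms `E exp(φ_j X_j(t))` and `E
exp(ψ Z(t))`, and self-similarity reduces each of them to time one, at the point `t^q φ_j` or `t^q
ψ`.

The unit-time law is known only through its characteristic function, that is, on the imaginary axis.
Phragmén–Lindelöf extends the formula to the closed left half-plane (`IsPosETS.integral_exp_mul`).
The exponent `∫ (e^{wr} - 1) e^{-βr} r^{-α-1} dr` is evaluated by differentiating in `w`, which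
produces a Gamma integral (`temperedExponent_eq`). -/

/-! ### The Laplace exponent and its closed form -/

lemma Complex.norm_exp_sub_one_le_norm_mul_exp_max (z : ℂ) :
    ‖Complex.exp z - 1‖ ≤ Real.exp (max z.re 0) * ‖z‖ := by
  -- Mean value inequality on a half-plane containing both `0` and `z`.
  have h := (convex_halfSpace_re_le (max z.re 0)).norm_image_sub_le_of_norm_hasDerivWithin_le
    (f := Complex.exp) (f' := Complex.exp) (C := Real.exp (max z.re 0)) (x := 0) (y := z)
    (fun w _ => (Complex.hasDerivAt_exp w).hasDerivWithinAt)
    (fun w hw => by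
      rw [Complex.norm_exp]
      exact Real.exp_le_exp.2 hw)
    (by simp) (by simp)
  simpa using h

/-- The density of the one-dimensional exponential tempered stable Lévy measure. -/
noncomputable def temperedKernel (α β r : ℝ) : ℝ := Real.exp (-(β * r)) / r ^ (α + 1)

lemma measurable_temperedKernel (α β : ℝ) : Measurable (temperedKernel α β) := by
  unfold temperedKernel; fun_prop

lemma temperedKernel_nonneg (α β : ℝ) {r : ℝ} (hr : 0 < r) : 0 ≤ temperedKernel α β r := by
  unfold temperedKernel; positivity

/-- One factor `r`, gained from `e^{wr} - 1` or from differentiation, makes the singularity at `0`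
integrable, since `α < 1`. -/
lemma temperedKernel_mul_self (α β : ℝ) {r : ℝ} (hr : 0 < r) :
    temperedKernel α β r * r = r ^ (-α) * Real.exp (-(β * r)) := by
  rw [temperedKernel, Real.rpow_add hr, Real.rpow_neg hr.le, Real.rpow_one]
  field_simp

lemma integrableOn_rpow_neg_mul_exp {α b : ℝ} (hα : α < 1) (hb : 0 < b) :
    IntegrableOn (fun r : ℝ => r ^ (-α) * Real.exp (-(b * r))) (Set.Ioi 0) := by
  simpa using integrableOn_rpow_mul_exp_neg_mul_rpow (s := -α) (p := 1) (by linarith) one_pos hb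

/-- The Laplace exponent of the one-dimensional exponential tempered stable law. -/
noncomputable def temperedExponent (α β : ℝ) (w : ℂ) : ℂ :=
  ∫ r in Set.Ioi (0 : ℝ), (temperedKernel α β r : ℂ) * (Complex.exp (w * r) - 1)

lemma integrableOn_temperedKernel_mul {α β : ℝ} (hα : α < 1) (hβ : 0 < β) {w : ℂ}
    (hw : w.re < β) :
    IntegrableOn (fun r : ℝ => (temperedKernel α β r : ℂ) * (Complex.exp (w * r) - 1))
      (Set.Ioi 0) := by
  have hb : 0 < β - max w.re 0 := by simp [hw, hβ]
  refine ((integrableOn_rpow_neg_mul_exp hα hb).const_mul ‖w‖).mono' ?_ ?_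
  · have := measurable_temperedKernel α β
    fun_prop
  · refine (ae_restrict_iff' measurableSet_Ioi).2 (ae_of_all _ fun r (hr : 0 < r) => ?_)
    have h := Complex.norm_exp_sub_one_le_norm_mul_exp_max (w * r)
    have hm : max (w * r).re 0 = max w.re 0 * r := by
      rw [Complex.re_mul_ofReal, max_mul_of_nonneg _ _ hr.le, zero_mul]
    rw [hm, norm_mul, Complex.norm_real, Real.norm_of_nonneg hr.le] at h
    rw [norm_mul, Complex.norm_real, Real.norm_of_nonneg (temperedKernel_nonneg α β hr)]
    calc _ ≤ temperedKernel α β r * (Real.exp (max w.re 0 * r) * (‖w‖ * r)) := by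
          gcongr
          exact temperedKernel_nonneg α β hr
      _ = ‖w‖ * (temperedKernel α β r * r * Real.exp (max w.re 0 * r)) := by ring
      _ = _ := by
          rw [temperedKernel_mul_self α β hr, mul_assoc, ← Real.exp_add]
          ring_nf

lemma hasDerivAt_temperedExponent {α β : ℝ} (hα : α < 1) (hβ : 0 < β) {w : ℂ}
    (hw : w.re < β) :
    HasDerivAt (temperedExponent α β)
      (∫ r in Set.Ioi (0 : ℝ), (temperedKernel α β r : ℂ) * (r * Complex.exp (w * r))) w := by
  have hk := measurable_temperedKernel α β
  -- The margin `β - c` is the exponential decay rate that dominates uniformly near `w`.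
  obtain ⟨c, hwc, hcβ⟩ := exists_between hw
  have hs : {v : ℂ | v.re < c} ∈ 𝓝 w :=
    (isOpen_lt Complex.continuous_re continuous_const).mem_nhds hwc
  refine (hasDerivAt_integral_of_dominated_loc_of_deriv_le (𝕜 := ℂ) (μ := volume.restrict (Set.Ioi 0))
    (F := fun v (r : ℝ) => (temperedKernel α β r : ℂ) * (Complex.exp (v * r) - 1))
    (bound := fun r : ℝ => r ^ (-α) * Real.exp (-((β - c) * r)))
    (F' := fun v (r : ℝ) => (temperedKernel α β r : ℂ) * (r * Complex.exp (v * r))) hs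
    (Eventually.of_forall fun v => by fun_prop) (integrableOn_temperedKernel_mul hα hβ hw)
    (by fun_prop) ?_ (integrableOn_rpow_neg_mul_exp hα (by linarith)) ?_).2
  · refine (ae_restrict_iff' measurableSet_Ioi).2 (ae_of_all _ fun r (hr : 0 < r) v hv => ?_)
    rw [norm_mul, norm_mul, Complex.norm_real, Complex.norm_real,
      Real.norm_of_nonneg (temperedKernel_nonneg α β hr), Real.norm_of_nonneg hr.le,
      ← mul_assoc, temperedKernel_mul_self α β hr, Complex.norm_exp, Complex.re_mul_ofReal,
      mul_assoc, ← Real.exp_add]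
    have hv' : v.re < c := hv
    gcongr
    nlinarith
  · refine ae_of_all _ fun r v _ => ?_
    have h := (((hasDerivAt_id v).mul_const (r : ℂ)).cexp.sub_const 1).const_mul
      (temperedKernel α β r : ℂ)
    refine h.congr_deriv ?_
    simp only [id]
    ring

/-- The integrand has nonpositive real part, because `Re e^{wr} ≤ |e^{wr}| ≤ 1`. This bound feeds
Phragmén–Lindelöf. -/
lemma norm_exp_temperedExponent_le_one {α β lam : ℝ} (hα : α < 1) (hβ : 0 < β) (hlam : 0 ≤ lam)
    {w : ℂ} (hw : w.re ≤ 0) : ‖Complex.exp (lam * temperedExponent α β w)‖ ≤ 1 := by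
  rw [Complex.norm_exp, Real.exp_le_one_iff, Complex.re_ofReal_mul]
  refine mul_nonpos_of_nonneg_of_nonpos hlam ?_
  have h := integral_re (𝕜 := ℂ) (integrableOn_temperedKernel_mul hα hβ (hw.trans_lt hβ)).integrable
  unfold temperedExponent
  rw [← RCLike.re_to_complex]
  rw [← h]
  refine integral_nonpos_of_ae ?_
  refine (ae_restrict_iff' measurableSet_Ioi).2 (ae_of_all _ fun r (hr : 0 < r) => ?_)
  simp only [RCLike.re_to_complex, Complex.re_ofReal_mul, Complex.sub_re, Complex.one_re,
    Pi.zero_apply]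
  refine mul_nonpos_of_nonneg_of_nonpos (temperedKernel_nonneg α β hr) (sub_nonpos.2 ?_)
  refine (Complex.re_le_norm _).trans ?_
  rw [Complex.norm_exp, Real.exp_le_one_iff, Complex.re_mul_ofReal]
  exact mul_nonpos_of_nonpos_of_nonneg hw hr.le

/-- `β - w` stays in the right half-plane, where the principal power is holomorphic; the constant
comes from `Γ(1-α) = -α Γ(-α)`. -/
lemma hasDerivAt_gamma_mul_cpow {α β : ℝ} (h0 : 0 < α) {w : ℂ} (hw : w.re < β) :
    HasDerivAt (fun w : ℂ => ((Real.Gamma (-α) : ℝ) : ℂ) *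
      (((β : ℂ) - w) ^ (α : ℂ) - ((β ^ α : ℝ) : ℂ)))
      (((Real.Gamma (1 - α) : ℝ) : ℂ) * ((β : ℂ) - w) ^ ((α : ℂ) - 1)) w := by
  have hs : (β : ℂ) - w ∈ Complex.slitPlane := Or.inl (by simpa using hw)
  have h := ((((hasDerivAt_id w).const_sub (β : ℂ)).cpow_const (c := (α : ℂ)) hs).sub_const
    ((β ^ α : ℝ) : ℂ)).const_mul ((Real.Gamma (-α) : ℝ) : ℂ)
  refine h.congr_deriv ?_
  have hG : Real.Gamma (1 - α) = -α * Real.Gamma (-α) := by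
    rw [← Real.Gamma_add_one (by linarith : -α ≠ 0)]
    ring_nf
  rw [hG]
  simp only [id]
  push_cast
  ring

lemma integral_temperedKernel_mul_ofReal {α β : ℝ} (hα : α < 1) {x : ℝ} (hx : x < β) :
    ∫ r in Set.Ioi (0 : ℝ), (temperedKernel α β r : ℂ) * (r * Complex.exp (x * r)) =
      ((Real.Gamma (1 - α) : ℝ) : ℂ) * ((β : ℂ) - x) ^ ((α : ℂ) - 1) := by
  have h := Real.integral_rpow_mul_exp_neg_mul_Ioi (a := 1 - α) (r := β - x)
    (by linarith) (by linarith)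
  have hb : 0 < β - x := by linarith
  have e : ((β : ℂ) - x) ^ ((α : ℂ) - 1) = (((1 / (β - x)) ^ (1 - α) : ℝ) : ℂ) := by
    rw [one_div, Real.inv_rpow hb.le, ← Real.rpow_neg hb.le, Complex.ofReal_cpow hb.le]
    push_cast
    ring_nf
  rw [e, ← Complex.ofReal_mul, mul_comm (Real.Gamma _), ← h, ← integral_complex_ofReal]
  refine setIntegral_congr_fun measurableSet_Ioi fun r (hr : 0 < r) => ?_
  have h2 := temperedKernel_mul_self α β hr
  rw [← Complex.ofReal_mul, ← Complex.ofReal_exp, ← Complex.ofReal_mul, ← Complex.ofReal_mul,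
    ← mul_assoc, h2, mul_assoc, ← Real.exp_add]
  ring_nf

/-- Closed form of the Laplace exponent of the exponential tempered stable law. -/
theorem temperedExponent_eq {α β : ℝ} (h0 : 0 < α) (hα : α < 1) (hβ : 0 < β) {w : ℂ}
    (hw : w.re < β) :
    temperedExponent α β w = ((Real.Gamma (-α) : ℝ) : ℂ) *
      (((β : ℂ) - w) ^ (α : ℂ) - ((β ^ α : ℝ) : ℂ)) := by
  set U : Set ℂ := {v | v.re < β} with hU
  have hUo : IsOpen U := isOpen_lt Complex.continuous_re continuous_const
  have hUc : IsPreconnected U := (convex_halfSpace_re_lt β).isPreconnected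
  have h0U : (0 : ℂ) ∈ U := by simpa [hU] using hβ
  have hf : DifferentiableOn ℂ (temperedExponent α β) U := fun v hv =>
    (hasDerivAt_temperedExponent hα hβ hv).differentiableAt.differentiableWithinAt
  have hg : DifferentiableOn ℂ (fun w : ℂ => ((Real.Gamma (-α) : ℝ) : ℂ) *
      (((β : ℂ) - w) ^ (α : ℂ) - ((β ^ α : ℝ) : ℂ))) U := fun v hv =>
    (hasDerivAt_gamma_mul_cpow h0 hv).differentiableAt.differentiableWithinAt
  refine hUo.eqOn_of_deriv_eq hUc hf hg ?_ h0U ?_ hw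
  -- The derivatives are compared only at negative reals, where a real Gamma integral suffices.
  -- These accumulate at `0`, so the identity theorem covers the half-plane.
  · refine AnalyticOnNhd.eqOn_of_preconnected_of_frequently_eq (z₀ := 0)
      ((hf.deriv hUo).analyticOnNhd hUo) ((hg.deriv hUo).analyticOnNhd hUo) hUc h0U ?_
    have ht : Tendsto (fun x : ℝ => (x : ℂ)) (𝓝[<] 0) (𝓝[≠] 0) := by
      refine tendsto_nhdsWithin_iff.2 ⟨?_, ?_⟩
      · exact (Complex.continuous_ofReal.tendsto' 0 0 (by simp)).mono_left nhdsWithin_le_nhds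
      · filter_upwards [self_mem_nhdsWithin] with x (hx : x < 0)
        simpa using hx.ne
    refine ht.frequently (Eventually.frequently ?_)
    filter_upwards [self_mem_nhdsWithin] with x (hx : x < 0)
    have hxβ : (x : ℂ).re < β := by simpa using hx.trans hβ
    rw [(hasDerivAt_temperedExponent hα hβ hxβ).deriv, (hasDerivAt_gamma_mul_cpow h0 hxβ).deriv]
    exact integral_temperedKernel_mul_ofReal hα (hx.trans hβ)
  · simp [temperedExponent, Complex.ofReal_cpow hβ.le]

/-! ### Laplace transform of the unit-time law -/

/-- The spherical measure is a point mass at `1`, so the polar integral collapses to the half-line.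
-/
lemma IsPosETS.charFun_eq_exp {α β lam : ℝ} (hlam : 0 ≤ lam) {μ : Measure ℝ}
    (h : IsPosETS α β lam μ) (z : ℝ) :
    charFun μ z = Complex.exp (lam * temperedExponent α β (z * Complex.I)) := by
  rw [IsETS.charFun_eq h z, etsLevyMeasure]
  congr 1
  rw [integral_map (by fun_prop) (by fun_prop), integral_withDensity_eq_integral_toReal_smul
    (by fun_prop) (by simp), Measure.prod_smul_left, integral_smul_measure, Measure.dirac_prod,
    integral_map (by fun_prop) (by fun_prop), ENNReal.toReal_ofReal hlam, temperedExponent,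
    Complex.real_smul]
  congr 1
  refine setIntegral_congr_fun measurableSet_Ioi fun r (hr : 0 < r) => ?_
  have hk := temperedKernel_nonneg α β hr
  rw [temperedKernel] at hk
  simp only [temperedKernel, smul_eq_mul, mul_one, ENNReal.toReal_ofReal hk, Complex.real_smul]
  congr 3
  simp
  ring

lemma norm_exp_mul_ofReal_le_one {w : ℂ} {x : ℝ} (hw : w.re ≤ 0) (hx : 0 ≤ x) :
    ‖Complex.exp (w * x)‖ ≤ 1 := by
  rw [Complex.norm_exp, Real.exp_le_one_iff, Complex.re_mul_ofReal]
  exact mul_nonpos_of_nonpos_of_nonneg hw hx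

lemma continuousOn_integral_exp_mul {μ : Measure ℝ} [IsProbabilityMeasure μ]
    (hμ : ∀ᵐ x ∂μ, 0 ≤ x) :
    ContinuousOn (fun w : ℂ => ∫ x, Complex.exp (w * (x : ℝ)) ∂μ) {w | w.re ≤ 0} := by
  refine continuousOn_of_dominated (bound := fun _ => 1) (fun w _ => by fun_prop) ?_
    (integrable_const _) (ae_of_all _ fun x => by fun_prop)
  intro w hw
  filter_upwards [hμ] with x hx using norm_exp_mul_ofReal_le_one hw hx

lemma differentiableAt_integral_exp_mul {μ : Measure ℝ} [IsProbabilityMeasure μ]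
    (hμ : ∀ᵐ x ∂μ, 0 ≤ x) {w : ℂ} (hw : w.re < 0) :
    DifferentiableAt ℂ (fun w : ℂ => ∫ x, Complex.exp (w * (x : ℝ)) ∂μ) w := by
  have hsub : Set.Iic 0 ⊆ integrableExpSet id μ := fun s (hs : s ≤ 0) => by
    refine (integrable_const (1 : ℝ)).mono' (by fun_prop) ?_
    filter_upwards [hμ] with x hx
    rw [Real.norm_eq_abs, Real.abs_exp, Real.exp_le_one_iff]
    exact mul_nonpos_of_nonpos_of_nonneg hs hx
  refine (hasDerivAt_complexMGF (X := id) (interior_mono hsub ?_)).differentiableAt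
  rwa [interior_Iic]

/-- The Laplace transform of a positive exponential tempered stable law on the closed left
half-plane. -/
theorem IsPosETS.integral_exp_mul {α β lam : ℝ} (hlam : 0 ≤ lam) {μ : Measure ℝ}
    (h : IsPosETS α β lam μ) (hμ : ∀ᵐ x ∂μ, 0 ≤ x) {w : ℂ} (hw : w.re ≤ 0) :
    ∫ x, Complex.exp (w * (x : ℝ)) ∂μ = Complex.exp (lam * temperedExponent α β w) := by
  have : IsProbabilityMeasure μ := h.prob
  have hα := h.alpha_lt_one
  have hβ : 0 < β := h.beta_pos ⟨1, by simp⟩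
  set L : ℂ → ℂ := fun w => ∫ x, Complex.exp (w * (x : ℝ)) ∂μ with hL
  set G : ℂ → ℂ := fun w => Complex.exp (lam * temperedExponent α β w) with hG
  have hdG : ∀ v : ℂ, v.re ≤ 0 → DifferentiableAt ℂ G v := fun v hv =>
    ((hasDerivAt_temperedExponent hα hβ (hv.trans_lt hβ)).differentiableAt.const_mul _).cexp
  have hbL : ∀ v : ℂ, v.re ≤ 0 → ‖L v‖ ≤ 1 := fun v hv => by
    have := norm_integral_le_of_norm_le_const (μ := μ) (C := 1)
      (hμ.mono fun x hx => norm_exp_mul_ofReal_le_one hv hx)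
    simpa using this
  have hb : ∀ v : ℂ, 0 ≤ v.re → ‖L (-v) - G (-v)‖ ≤ 2 := fun v hv => by
    have hv' : (-v).re ≤ 0 := by simpa using hv
    linarith [norm_sub_le (L (-v)) (G (-v)), hbL _ hv',
      norm_exp_temperedExponent_le_one hα hβ hlam hv']
  -- The map `v ↦ -v` swaps the half-planes. The bound `C = 0` on the imaginary axis, where both
  -- sides are the characteristic function, forces equality throughout.
  have key := PhragmenLindelof.right_half_plane_of_bounded_on_real (z := -w) (C := 0)
    (f := fun v => L (-v) - G (-v)) ⟨?_, ?_⟩ ?_ ?_ ?_ (by simpa using hw)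
  · simpa [sub_eq_zero] using key
  · intro v (hv : 0 < v.re)
    have hv' : (-v).re < 0 := by simpa using hv
    refine DifferentiableAt.differentiableWithinAt ?_
    exact ((differentiableAt_integral_exp_mul hμ hv').comp v differentiableAt_id.neg).sub
      ((hdG _ hv'.le).comp v differentiableAt_id.neg)
  · rw [Complex.closure_setOfPred_lt_re]
    have hm : Set.MapsTo (fun v : ℂ => -v) {v | 0 ≤ v.re} {v | v.re ≤ 0} := fun v hv => by
      simpa using hv
    have hcG : ContinuousOn G {v | v.re ≤ 0} := fun v hv =>
      (hdG v hv).continuousAt.continuousWithinAt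
    exact ((continuousOn_integral_exp_mul hμ).comp continuous_neg.continuousOn hm).sub
      (hcG.comp continuous_neg.continuousOn hm)
  -- With coefficient `0` in the exponent the growth condition is plain boundedness.
  · refine ⟨1, one_lt_two, 0, Asymptotics.IsBigO.of_bound 2 ?_⟩
    refine Filter.eventually_inf_principal.2 (Eventually.of_forall fun v hv => ?_)
    simpa using hb v (le_of_lt hv)
  · exact ⟨2, eventually_map.2 <| (eventually_ge_atTop 0).mono fun x hx => hb x (by simpa using hx)⟩
  · intro x
    have hc := h.charFun_eq_exp hlam (-x)
    rw [charFun_apply_real] at hc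
    have e : -((x : ℂ) * Complex.I) = ((-x : ℝ) : ℂ) * Complex.I := by simp
    simp only [e, hL, hG, ← hc]
    rw [norm_le_zero_iff, sub_eq_zero]
    refine integral_congr_ae (ae_of_all _ fun y => ?_)
    simp only
    ring_nf

/-! ### Sato subordinators: reduction to time one -/

lemma IsSatoSubordinator.nonneg {Ω : Type*} [MeasurableSpace Ω] {q : ℝ} {X : ℝ≥0 → Ω → ℝ}
    {P : Measure Ω} (hX : IsSatoSubordinator q X P) (t : ℝ≥0) : ∀ᵐ ω ∂P, 0 ≤ X t ω := by
  filter_upwards [hX.zero, hX.mono] with ω h0 hm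
  exact h0 ▸ hm (zero_le : 0 ≤ t)

/-- The Laplace transform of an exponential tempered stable Sato subordinator at time `t`. -/
theorem IsSatoSubordinator.integral_exp_mul {Ω : Type*} [MeasurableSpace Ω] {P : Measure Ω}
    {α β lam q : ℝ} (hlam : 0 ≤ lam) {X : ℝ≥0 → Ω → ℝ} (hX : IsSatoSubordinator q X P)
    (h : IsPosETS α β lam (P.map (X 1))) {t : ℝ≥0} (ht : 0 < t) {w : ℂ} (hw : w.re ≤ 0) :
    ∫ ω, Complex.exp (w * X t ω) ∂P =
      Complex.exp (((Real.Gamma (-α) : ℝ) : ℂ) *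
        (((β : ℂ) - (((t : ℝ) ^ q : ℝ) : ℂ) * w) ^ (α : ℂ) - ((β ^ α : ℝ) : ℂ)) * lam) := by
  have hβ : 0 < β := h.beta_pos ⟨1, by simp⟩
  have htq : 0 ≤ (t : ℝ) ^ q := Real.rpow_nonneg t.2 q
  have hw' : ((((t : ℝ) ^ q : ℝ) : ℂ) * w).re ≤ 0 := by
    rw [Complex.re_ofReal_mul]
    exact mul_nonpos_of_nonneg_of_nonpos htq hw
  -- Scaling by `c = t`, read at index `1`: `X t` has the law of `t^q X 1`.
  have hid := (hX.self_similar t ht).comp (measurable_pi_apply 1)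
  have hid' := (hid.comp (u := fun x : ℝ => Complex.exp (w * x)) (by fun_prop)).integral_eq
  simp only [Function.comp_def, mul_one, smul_eq_mul] at hid'
  have hm := hX.measurable 1
  have hL := h.integral_exp_mul hlam
    ((ae_map_iff hm.aemeasurable measurableSet_Ici).2 (hX.nonneg 1)) hw'
  rw [integral_map hm.aemeasurable (by fun_prop),
    temperedExponent_eq h.alpha_pos h.alpha_lt_one hβ (hw'.trans_lt hβ)] at hL
  rw [hid', mul_comm _ (lam : ℂ), ← hL]
  refine integral_congr_ae (ae_of_all _ fun ω => ?_)
  simp only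
  push_cast
  ring_nf

/-! ### Continuous processes at independent random clocks -/

/-- The largest point of the grid of mesh `1 / n` not exceeding `x`. -/
noncomputable def gridFloor (n : ℕ) (x : ℝ≥0) : ℝ≥0 := (⌊x * n⌋₊ : ℝ≥0) / n

lemma tendsto_gridFloor (x : ℝ≥0) : Tendsto (fun n => gridFloor n x) atTop (𝓝 x) := by
  rw [← NNReal.tendsto_coe]
  have h := (tendsto_nat_floor_mul_div_atTop (R := ℝ) x.2).comp tendsto_natCast_atTop_atTop
  refine h.congr fun n => ?_
  simp only [gridFloor, Function.comp_apply, NNReal.coe_div, NNReal.coe_natCast]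
  congr 2

/-- Evaluation `(x, path) ↦ path x` is not jointly measurable for the product σ-algebra on paths.
Rounding `x` leaves countably many times, each with a measurable evaluation. -/
lemma measurable_eval_gridFloor {E : Type*} [MeasurableSpace E] (n : ℕ) :
    Measurable (fun p : ℝ≥0 × (ℝ≥0 → E) => p.2 (gridFloor n p.1)) := by
  have h : Measurable (fun p : ℕ × (ℝ≥0 → E) => p.2 ((p.1 : ℝ≥0) / n)) :=
    measurable_from_prod_countable_right fun k => measurable_pi_apply ((k : ℝ≥0) / n)
  have h2 : Measurable (fun p : ℝ≥0 × (ℝ≥0 → E) => (⌊p.1 * n⌋₊, p.2)) := by fun_prop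
  exact h.comp h2

/-- The terminal value of a sum of one-dimensional paths run at the clocks `τ.1` and a common
vector-valued path run at the clock `τ.2`. -/
def subordinatedValue {d : ℕ} (τ : (Fin d → ℝ≥0) × ℝ≥0)
    (b : (Fin d → ℝ≥0 → ℝ) × (ℝ≥0 → EuclideanSpace ℝ (Fin d))) : EuclideanSpace ℝ (Fin d) :=
  WithLp.toLp 2 fun j => b.1 j (τ.1 j) + b.2 τ.2 j

/-- Rounding both clocks down to the grid of mesh `1 / n`. -/
noncomputable def gridClock {d : ℕ} (n : ℕ) (τ : (Fin d → ℝ≥0) × ℝ≥0) :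
    (Fin d → ℝ≥0) × ℝ≥0 := (fun j => gridFloor n (τ.1 j), gridFloor n τ.2)

lemma measurable_subordinatedValue_gridClock {d : ℕ} (n : ℕ) :
    Measurable (fun p : ((Fin d → ℝ≥0) × ℝ≥0) ×
      ((Fin d → ℝ≥0 → ℝ) × (ℝ≥0 → EuclideanSpace ℝ (Fin d))) =>
      subordinatedValue (gridClock n p.1) p.2) := by
  unfold subordinatedValue gridClock
  refine (WithLp.measurable_toLp 2 _).comp (measurable_pi_lambda _ fun j => ?_)
  have h1 := (measurable_eval_gridFloor (E := ℝ) n).comp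
    (f := fun p : ((Fin d → ℝ≥0) × ℝ≥0) ×
      ((Fin d → ℝ≥0 → ℝ) × (ℝ≥0 → EuclideanSpace ℝ (Fin d))) => (p.1.1 j, p.2.1 j)) (by fun_prop)
  have h2 := (measurable_eval_gridFloor (E := EuclideanSpace ℝ (Fin d)) n).comp
    (f := fun p : ((Fin d → ℝ≥0) × ℝ≥0) ×
      ((Fin d → ℝ≥0 → ℝ) × (ℝ≥0 → EuclideanSpace ℝ (Fin d))) => (p.1.2, p.2.2)) (by fun_prop)
  exact h1.add ((show Measurable fun v : EuclideanSpace ℝ (Fin d) => v j by fun_prop).comp h2)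

lemma tendsto_subordinatedValue_gridClock {d : ℕ} (τ : (Fin d → ℝ≥0) × ℝ≥0)
    {b : (Fin d → ℝ≥0 → ℝ) × (ℝ≥0 → EuclideanSpace ℝ (Fin d))}
    (h1 : ∀ j, Continuous (b.1 j)) (h2 : Continuous b.2) :
    Tendsto (fun n => subordinatedValue (gridClock n τ) b) atTop (𝓝 (subordinatedValue τ b)) := by
  have h : Continuous (fun σ : (Fin d → ℝ≥0) × ℝ≥0 => subordinatedValue σ b) := by
    unfold subordinatedValue
    refine (PiLp.continuous_toLp 2 _).comp (continuous_pi fun j => ?_)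
    have h3 : Continuous (fun σ : (Fin d → ℝ≥0) × ℝ≥0 => b.2 σ.2) := by fun_prop
    have h4 : Continuous (fun σ : (Fin d → ℝ≥0) × ℝ≥0 => b.1 j (σ.1 j)) :=
      (h1 j).comp (by fun_prop)
    fun_prop
  refine (h.tendsto τ).comp ?_
  exact (tendsto_pi_nhds.2 fun j => tendsto_gridFloor _).prodMk_nhds (tendsto_gridFloor _)

/-- The characteristic function of continuous processes run at independent random clocks. -/
theorem charFun_subordinatedValue {Ω : Type*} [MeasurableSpace Ω] {P : Measure Ω}
    [IsProbabilityMeasure P] {d : ℕ} {τ : Ω → (Fin d → ℝ≥0) × ℝ≥0}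
    {b : Ω → (Fin d → ℝ≥0 → ℝ) × (ℝ≥0 → EuclideanSpace ℝ (Fin d))}
    (hτ : Measurable τ) (hb : Measurable b) (hind : IndepFun τ b P)
    (hc : ∀ᵐ ω ∂P, (∀ j, Continuous ((b ω).1 j)) ∧ Continuous (b ω).2)
    (z : EuclideanSpace ℝ (Fin d)) {Φ : (Fin d → ℝ≥0) × ℝ≥0 → ℂ} (hΦ : Continuous Φ)
    (hbΦ : ∀ s, ‖Φ s‖ ≤ 1)
    (hchar : ∀ s, ∫ ω, Complex.exp (inner ℝ (subordinatedValue s (b ω)) z * Complex.I) ∂P = Φ s) :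
    charFun (P.map fun ω => subordinatedValue (τ ω) (b ω)) z = ∫ ω, Φ (τ ω) ∂P := by
  have hlim : ∀ᵐ ω ∂P, Tendsto (fun n => subordinatedValue (gridClock n (τ ω)) (b ω)) atTop
      (𝓝 (subordinatedValue (τ ω) (b ω))) :=
    hc.mono fun ω h => tendsto_subordinatedValue_gridClock _ h.1 h.2
  have hmeas : ∀ n, Measurable (fun ω => subordinatedValue (gridClock n (τ ω)) (b ω)) := fun n =>
    (measurable_subordinatedValue_gridClock n).comp (hτ.prodMk hb)
  -- Path continuity makes the subordinated value an a.e. limit of measurable maps; without a.e.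
  -- measurability the pushforward would be the zero measure by default.
  have hae := aemeasurable_of_tendsto_metrizable_ae atTop (fun n => (hmeas n).aemeasurable) hlim
  rw [charFun_apply, integral_map hae (by fun_prop)]
  have hexp : Continuous (fun y : EuclideanSpace ℝ (Fin d) =>
    Complex.exp (inner ℝ y z * Complex.I)) := by fun_prop
  have hL : Tendsto (fun n => ∫ ω, Complex.exp
      (inner ℝ (subordinatedValue (gridClock n (τ ω)) (b ω)) z * Complex.I) ∂P) atTop
      (𝓝 (∫ ω, Complex.exp (inner ℝ (subordinatedValue (τ ω) (b ω)) z * Complex.I) ∂P)) := by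
    refine tendsto_integral_of_dominated_convergence (fun _ => 1)
      (fun n => (hexp.measurable.comp (hmeas n)).aestronglyMeasurable) (integrable_const _)
      (fun n => ae_of_all _ fun ω => (Complex.norm_exp_ofReal_mul_I _).le) ?_
    exact hlim.mono fun ω h => (hexp.tendsto _).comp h
  -- For rounded clocks the integrand is jointly measurable, so independence and Fubini allow the
  -- clock to be frozen.
  have hstep : ∀ n, ∫ ω, Complex.exp
      (inner ℝ (subordinatedValue (gridClock n (τ ω)) (b ω)) z * Complex.I) ∂P =
      ∫ ω, Φ (gridClock n (τ ω)) ∂P := fun n => by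
    have hF := hexp.measurable.comp (measurable_subordinatedValue_gridClock (d := d) n)
    have hg : Measurable (gridClock (d := d) n) := by
      unfold gridClock gridFloor; fun_prop
    rw [← integral_map (f := fun p : ((Fin d → ℝ≥0) × ℝ≥0) ×
        ((Fin d → ℝ≥0 → ℝ) × (ℝ≥0 → EuclideanSpace ℝ (Fin d))) => Complex.exp
        (inner ℝ (subordinatedValue (gridClock n p.1) p.2) z * Complex.I))
      (hτ.prodMk hb).aemeasurable hF.aestronglyMeasurable,
      (indepFun_iff_map_prod_eq_prod_map_map hτ.aemeasurable hb.aemeasurable).1 hind]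
    have := Measure.isProbabilityMeasure_map (μ := P) hτ.aemeasurable
    have := Measure.isProbabilityMeasure_map (μ := P) hb.aemeasurable
    rw [integral_prod]
    · rw [integral_map hτ.aemeasurable]
      · refine integral_congr_ae (ae_of_all _ fun ω => ?_)
        simp only
        rw [integral_map hb.aemeasurable, hchar]
        exact (hF.comp measurable_prodMk_left).aestronglyMeasurable
      · exact hF.stronglyMeasurable.integral_prod_right'.aestronglyMeasurable
    · refine (integrable_const (1 : ℝ)).mono' hF.aestronglyMeasurable
        (ae_of_all _ fun p => (Complex.norm_exp_ofReal_mul_I _).le)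
  have hR : Tendsto (fun n => ∫ ω, Φ (gridClock n (τ ω)) ∂P) atTop (𝓝 (∫ ω, Φ (τ ω) ∂P)) := by
    have hg : ∀ n, Measurable (gridClock (d := d) n) := fun n => by
      unfold gridClock gridFloor; fun_prop
    refine tendsto_integral_of_dominated_convergence (fun _ => 1)
      (fun n => (hΦ.measurable.comp ((hg n).comp hτ)).aestronglyMeasurable) (integrable_const _)
      (fun n => ae_of_all _ fun ω => hbΦ _) (ae_of_all _ fun ω => (hΦ.tendsto _).comp ?_)
    exact (tendsto_pi_nhds.2 fun j => tendsto_gridFloor _).prodMk_nhds (tendsto_gridFloor _)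
  simp only [hstep] at hL
  exact tendsto_nhds_unique hL hR

/-! ### Gaussian exponents of the Brownian parts -/

lemma IsContinuousWithIncrementLaw.hasLaw {Ω E : Type*} [MeasurableSpace Ω]
    [NormedAddCommGroup E] [MeasurableSpace E] {law : ℝ≥0 → Measure E} {W : ℝ≥0 → Ω → E}
    {P : Measure Ω} (h : IsContinuousWithIncrementLaw law W P) (t : ℝ≥0) :
    HasLaw (W t) (law t) P := by
  have := h.increments 0 t zero_le
  rw [tsub_zero] at this
  exact this.congr (h.zero.mono fun ω hω => by simp [hω])

lemma IsRealBM.integral_exp {Ω : Type*} [MeasurableSpace Ω] {P : Measure Ω} {m σ : ℝ}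
    {W : ℝ≥0 → Ω → ℝ} (h : IsRealBM m σ W P) (t : ℝ≥0) (z : ℝ) :
    ∫ ω, Complex.exp ((z * W t ω : ℝ) * Complex.I) ∂P =
      Complex.exp ((Complex.I * m * z - 1 / 2 * (σ : ℂ) ^ 2 * (z : ℂ) ^ 2) * ((t : ℝ) : ℂ)) := by
  have hl := IsContinuousWithIncrementLaw.hasLaw h t
  have hc := congrArg (fun μ => charFun μ z) hl.map_eq
  simp only [charFun_gaussianReal] at hc
  rw [charFun_apply_real, integral_map hl.aemeasurable (by fun_prop)] at hc
  have h0 : 0 ≤ σ ^ 2 * (t : ℝ) := by positivity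
  simp only [Real.coe_toNNReal _ h0] at hc
  push_cast at hc ⊢
  rw [hc]
  ring_nf

lemma IsVectorBM.integral_exp {Ω : Type*} [MeasurableSpace Ω] {P : Measure Ω} {d : ℕ}
    {m : Fin d → ℝ} {C : Matrix (Fin d) (Fin d) ℝ} (hC : C.PosSemidef)
    {W : ℝ≥0 → Ω → EuclideanSpace ℝ (Fin d)} (h : IsVectorBM m C W P) (t : ℝ≥0)
    (z : EuclideanSpace ℝ (Fin d)) :
    ∫ ω, Complex.exp ((inner ℝ (W t ω) z : ℝ) * Complex.I) ∂P =
      Complex.exp ((Complex.I * ((z.ofLp ⬝ᵥ m : ℝ) : ℂ)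
        - 1 / 2 * ((z.ofLp ⬝ᵥ (C *ᵥ z.ofLp) : ℝ) : ℂ)) * ((t : ℝ) : ℂ)) := by
  have hl := IsContinuousWithIncrementLaw.hasLaw h t
  have hc := congrArg (fun μ => charFun μ z) hl.map_eq
  have ht : ((t : ℝ) • C).PosSemidef := hC.smul t.2
  simp only [charFun_multivariateGaussian ht] at hc
  rw [charFun_apply, integral_map hl.aemeasurable (by fun_prop)] at hc
  rw [hc, EuclideanSpace.inner_eq_star_dotProduct]
  simp only [star_trivial, smul_dotProduct, Matrix.smul_mulVec, dotProduct_smul, smul_eq_mul]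
  rw [dotProduct_comm m]
  push_cast
  ring_nf

/-- The matrix is `D ρ D` with `D = diag(σ_j √a_j)`. -/
lemma rhoCov_posSemidef {d : ℕ} (a σ : Fin d → ℝ) {ρ : Matrix (Fin d) (Fin d) ℝ}
    (hρ : ρ.PosSemidef) : (rhoCov a σ ρ).PosSemidef := by
  have h := hρ.mul_mul_conjTranspose_same (Matrix.diagonal fun j => σ j * √(a j))
  convert h using 1
  ext i j
  simp [rhoCov]
  ring

/-- Places both Gaussian exponents in the half-plane where the Laplace formula holds. -/
lemma Complex.I_mul_sub_re_nonpos (x : ℝ) {y : ℝ} (hy : 0 ≤ y) :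
    (Complex.I * (x : ℂ) - 1 / 2 * (y : ℂ)).re ≤ 0 := by
  have : (Complex.I * (x : ℂ) - 1 / 2 * (y : ℂ)).re = -(y / 2) := by
    simp
    ring
  linarith

/-! ### The characteristic function of the subordinated process -/

theorem corollary5p3 {Ω : Type*} [MeasurableSpace Ω] (P : Measure Ω) [IsProbabilityMeasure P]
    (d : ℕ) (α q : ℝ) (a β lam : Fin d → ℝ) (βZ lamZ : ℝ)
    (S : ℝ≥0 → Ω → EuclideanSpace ℝ (Fin d)) (X : Fin d → ℝ≥0 → Ω → ℝ) (Z : ℝ≥0 → Ω → ℝ)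
    (hS : IsFactorSatoSubordinator α q a β lam βZ lamZ S X Z P)
    (m σ : Fin d → ℝ) (ρ : Matrix (Fin d) (Fin d) ℝ)
    (B : Fin d → ℝ≥0 → Ω → ℝ) (Bρ : ℝ≥0 → Ω → EuclideanSpace ℝ (Fin d))
    (hB : IsRhoBrownianPair a m σ ρ B Bρ P)
    (hindep : IndepFun
      (fun ω => ((fun (j : Fin d) (t : ℝ≥0) => X j t ω), (fun t : ℝ≥0 => Z t ω)))
      (fun ω => ((fun (j : Fin d) (t : ℝ≥0) => B j t ω), (fun t : ℝ≥0 => Bρ t ω))) P)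
    (t : ℝ≥0) (ht : 0 < t) (z : EuclideanSpace ℝ (Fin d)) :
    charFun (P.map (rhoFactorProcess X Z B Bρ t)) z =
      (∏ j, Complex.exp (((Real.Gamma (-α) : ℝ) : ℂ) *
        (((β j : ℂ) - (((t : ℝ) ^ q : ℝ) : ℂ) *
            (Complex.I * (m j : ℂ) * (z j : ℂ) - 1 / 2 * (σ j : ℂ) ^ 2 * (z j : ℂ) ^ 2)) ^ (α : ℂ)
          - ((β j ^ α : ℝ) : ℂ)) * (lam j : ℂ))) *
      Complex.exp (((Real.Gamma (-α) : ℝ) : ℂ) *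
        (((βZ : ℂ) - (((t : ℝ) ^ q : ℝ) : ℂ) *
            (Complex.I * ((z.ofLp ⬝ᵥ rhoDrift a m : ℝ) : ℂ)
              - 1 / 2 * ((z.ofLp ⬝ᵥ (rhoCov a σ ρ *ᵥ z.ofLp) : ℝ) : ℂ))) ^ (α : ℂ)
          - ((βZ ^ α : ℝ) : ℂ)) * (lamZ : ℂ)) := by
  have hC := rhoCov_posSemidef a σ hB.corr_posSemidef
  have mX := fun j s => (hS.sato_X j).measurable s
  have mZ := fun s => hS.sato_Z.measurable s
  have mB := fun j s => (hB.brownian_B j).measurable s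
  have mBρ := fun s => hB.brownian_Bρ.measurable s
  set φ : Fin d → ℂ := fun j =>
    Complex.I * (m j : ℂ) * (z j : ℂ) - 1 / 2 * (σ j : ℂ) ^ 2 * (z j : ℂ) ^ 2 with hφ
  set ψ : ℂ := Complex.I * ((z.ofLp ⬝ᵥ rhoDrift a m : ℝ) : ℂ)
    - 1 / 2 * ((z.ofLp ⬝ᵥ (rhoCov a σ ρ *ᵥ z.ofLp) : ℝ) : ℂ)
  have reφ : ∀ j, (φ j).re ≤ 0 := fun j => by
    have h := Complex.I_mul_sub_re_nonpos (m j * z j) (y := σ j ^ 2 * z j ^ 2) (by positivity)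
    convert h using 2
    simp only [hφ]
    push_cast
    ring
  have reψ : ψ.re ≤ 0 := Complex.I_mul_sub_re_nonpos _ (by
    simpa using hC.dotProduct_mulVec_nonneg z.ofLp)
  have hY : rhoFactorProcess X Z B Bρ t = fun ω => subordinatedValue
      (fun j => (X j t ω).toNNReal, (Z t ω).toNNReal) (fun j s => B j s ω, fun s => Bρ s ω) := rfl
  rw [hY, charFun_subordinatedValue
    (τ := fun ω => (fun j => (X j t ω).toNNReal, (Z t ω).toNNReal))
    (b := fun ω => (fun j s => B j s ω, fun s => Bρ s ω)) (by fun_prop) (by fun_prop)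
    (hindep.comp (φ := fun p => (fun j => (p.1 j t).toNNReal, (p.2 t).toNNReal)) (ψ := id)
      (by fun_prop) measurable_id) ?_ z
    (Φ := fun s => (∏ j, Complex.exp (φ j * ((s.1 j : ℝ) : ℂ))) * Complex.exp (ψ * ((s.2 : ℝ) : ℂ)))
    (by fun_prop) ?_ ?_]
  · have hXZ : ∀ᵐ ω ∂P, (∀ j, 0 ≤ X j t ω) ∧ 0 ≤ Z t ω :=
      (ae_all_iff.2 fun j => (hS.sato_X j).nonneg t).and (hS.sato_Z.nonneg t)
    have hprod : IndepFun (fun ω => ∏ j, Complex.exp (φ j * X j t ω))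
        (fun ω => Complex.exp (ψ * Z t ω)) P :=
      hS.indep_X_Z.comp (φ := fun x : Fin d → ℝ≥0 → ℝ => ∏ j, Complex.exp (φ j * x j t))
        (ψ := fun x : ℝ≥0 → ℝ => Complex.exp (ψ * x t)) (by fun_prop) (by fun_prop)
    have hfac : iIndepFun (fun j ω => Complex.exp (φ j * X j t ω)) P :=
      hS.indep_X.comp (fun j (x : ℝ≥0 → ℝ) => Complex.exp (φ j * x t)) (fun j => by fun_prop)
    -- The truncation `toNNReal` is almost surely inert, as the clocks are nonnegative.
    calc _ = ∫ ω, (∏ j, Complex.exp (φ j * X j t ω)) * Complex.exp (ψ * Z t ω) ∂P := by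
          refine integral_congr_ae (hXZ.mono fun ω h => ?_)
          simp only [Real.coe_toNNReal _ h.2, Real.coe_toNNReal _ (h.1 _)]
      _ = _ := by
          rw [hprod.integral_fun_mul_eq_mul_integral (by fun_prop) (by fun_prop),
            hfac.integral_fun_prod_eq_prod_integral (by fun_prop),
            hS.sato_Z.integral_exp_mul hS.lamZ_nonneg hS.law_Z ht reψ]
          congr 1
          exact Finset.prod_congr rfl fun j _ =>
            (hS.sato_X j).integral_exp_mul (hS.lam_nonneg j) (hS.law_X j) ht (reφ j)
  · exact (ae_all_iff.2 fun j => (hB.brownian_B j).continuous).and hB.brownian_Bρ.continuous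
  · intro s
    rw [norm_mul, norm_prod]
    exact mul_le_one₀ (Finset.prod_le_one (fun _ _ => norm_nonneg _)
      fun j _ => norm_exp_mul_ofReal_le_one (reφ j) (s.1 j).2) (norm_nonneg _)
      (norm_exp_mul_ofReal_le_one reψ s.2.2)
  · intro s
    have hprod : IndepFun (fun ω => ∏ j, Complex.exp ((z j * B j (s.1 j) ω : ℝ) * Complex.I))
        (fun ω => Complex.exp ((inner ℝ (Bρ s.2 ω) z : ℝ) * Complex.I)) P :=
      hB.indep_B_Bρ.comp
        (φ := fun x : Fin d → ℝ≥0 → ℝ => ∏ j, Complex.exp ((z j * x j (s.1 j) : ℝ) * Complex.I))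
        (ψ := fun x : ℝ≥0 → EuclideanSpace ℝ (Fin d) =>
          Complex.exp ((inner ℝ (x s.2) z : ℝ) * Complex.I)) (by fun_prop) (by fun_prop)
    have hfac : iIndepFun (fun j ω => Complex.exp ((z j * B j (s.1 j) ω : ℝ) * Complex.I)) P :=
      hB.indep_B.comp (fun j (x : ℝ≥0 → ℝ) => Complex.exp ((z j * x (s.1 j) : ℝ) * Complex.I))
        (fun j => by fun_prop)
    calc _ = ∫ ω, (∏ j, Complex.exp ((z j * B j (s.1 j) ω : ℝ) * Complex.I)) *
            Complex.exp ((inner ℝ (Bρ s.2 ω) z : ℝ) * Complex.I) ∂P := by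
          refine integral_congr_ae (ae_of_all _ fun ω => ?_)
          simp only
          -- At fixed times `⟨Y, z⟩ = ∑ z_j B_j(s_j) + ⟨Bρ(s_Z), z⟩`, a sum of independent terms.
          rw [← Complex.exp_sum, ← Complex.exp_add, ← Finset.sum_mul, ← add_mul,
            ← Complex.ofReal_sum, ← Complex.ofReal_add]
          congr 3
          simp [subordinatedValue, PiLp.inner_apply, mul_add, Finset.sum_add_distrib]
      _ = _ := by
          rw [hprod.integral_fun_mul_eq_mul_integral (by fun_prop) (by fun_prop),
            hfac.integral_fun_prod_eq_prod_integral (by fun_prop),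
            hB.brownian_Bρ.integral_exp hC]
          congr 1
          exact Finset.prod_congr rfl fun j _ => (hB.brownian_B j).integral_exp _ _
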